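/- Let $X$ be a separable infinite-dimensional complex Banach space, let $0\le I_1,I_2\le\infty$ not both be $0$, and let $$\{x^i_j : 1\le i<I_1+1,\ 1\le j<\infty\}\cup\{y^i_j : 1\le i<I_2+1,\ -\infty<j<\infty\}$$ be a normalised minimal fundamental system for $X$: all these vectors have norm $1$, their linear span is dense in $X$, and there are functionals $x^{i*}_j, y^{i*}_j\in X^*$ biorthogonal to the system, that is, each of them takes the value $1$ at the vector with the same label and $0$ at every other vector of the system. Let $S$ be a bounded linear operator on $X$ and let $a^i_j,b^i_j\in\mathbb C$ be such that $$Sx^i_j=a^i_jx^i_{j+1}\quad\text{and}\quad Sy^i_j=b^i_jy^i_{j+1}\qquad\text{for all } i,j.$$ Suppose that for each $i$ with $1\le i<I_1+1$ there is a strictly increasing sequence $(n^i_j)_{j\ge1}$ of positive integers with $|a^i_{n^i_j}|\,\|x^{i*}_{n^i_j}\|\to0$ as $j\to\infty$, and that for each $i$ with $1\le i<I_2+1$ there is a strictly increasing sequence $(m^i_j)_{j\ge1}$ of integers with $|b^i_{m^i_j}|\,\|y^{i*}_{m^i_j}\|\to0$ as $j\to\infty$. Then, for every $\lambda\in\mathbb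 C$ with $|\lambda|=1$, the operator $\lambda I+S$ lies in the operator-norm closure of the set of mixing operators on $X$. Here a bounded linear operator $T$ on $X$ is mixing if for all nonempty open $U,V\subseteq X$ there is $N$ such that $T^n(U)\cap V\ne\emptyset$ for all $n>N$. -/

import Mathlib

open Filter Topology

/-- A bounded operator `T` on `X` is mixing if for all nonempty open sets `U`, `V` there is `N`
with `T ^ n '' U` meeting `V` for every `n > N`. -/
def IsMixingOperator {X : Type*} [NormedAddCommGroup X] [NormedSpace ℂ X] (T : X →L[ℂ] X) : Prop :=
  ∀ U V : Set X, IsOpen U → IsOpen V → U.Nonempty → V.Nonempty →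
    ∃ N : ℕ, ∀ n : ℕ, N < n → (((T ^ n : X →L[ℂ] X) '' U) ∩ V).Nonempty

/-- The family `e` is normalised, minimal with biorthogonal functionals `f`, and fundamental
(its linear span is dense). -/
structure IsNormalisedMinimalFundamental {X : Type*} [NormedAddCommGroup X] [NormedSpace ℂ X]
    {α : Type*} (e : α → X) (f : α → (X →L[ℂ] ℂ)) : Prop where
  norm_eq_one : ∀ p, ‖e p‖ = 1
  apply_self : ∀ p, f p (e p) = 1
  apply_of_ne : ∀ p q, p ≠ q → f p (e q) = 0
  dense_span : Dense (Submodule.span ℂ (Set.range e) : Set X)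

/-- The labels of a list of `I` chains, where `0 ≤ I ≤ ∞`; they are counted from `0`. -/
abbrev ChainIndex (I : ℕ∞) : Type := {i : ℕ // (i : ℕ∞) < I}

/-- The system made of all the members of the unilateral chains `u` (positions counted from `0`)
and all the members of the bilateral chains `v`, as one family. -/
def chainSystem {I₁ I₂ : ℕ∞} {E : Type*} (u : ChainIndex I₁ → ℕ → E) (v : ChainIndex I₂ → ℤ → E) :
    (ChainIndex I₁ × ℕ) ⊕ (ChainIndex I₂ × ℤ) → E :=
  Sum.elim (fun p => u p.1 p.2) (fun p => v p.1 p.2)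

/-! Redirecting the image of one vector `e p` by a rank-one operator costs `‖f p‖` times the change,
so each chain can be cut cheaply where `‖a p‖ * ‖f p‖` is small. Number all the resulting blocks by
`ℕ`, send the end of block `n + 1` to a tiny multiple of a vector of block `n` and the end of block
`0` to `0`, and replace zero weights by tiny ones. The new operator `N` is close to `S`, and on the
dense span of the system it is surjective and locally nilpotent (`isMixingOperator_of_shift`).

This makes `l I + N` mixing (`isMixingOperator_smul_id_add`). After dividing by `l`, every vector of
the span lies on a chain `N (z (j + 1)) = z j`, `N (z 0) = 0`. Reading coordinates along the chain
as Newton coefficients of a polynomial turns `I + N` into the translation `P ↦ P (X + 1)`, and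
explicit polynomials steer orbits from `z d` to `0` and from `0` to `z d`. -/

section Criterion

/-! ### Mixing from surjectivity and local nilpotency on a dense subspace. -/

open Polynomial

variable {E : Type*} [NormedAddCommGroup E] [NormedSpace ℂ E]

/-- The vector with coordinates the first `m` Newton coefficients of `P` along the sequence `z`. -/
noncomputable def newtonSum (m : ℕ) (z : ℕ → E) (P : ℂ[X]) : E :=
  ∑ j ∈ Finset.range m, ((fwdDiff (1 : ℂ))^[j] P.eval 0) • z j

/-- Translation by 1 is `1 + Δ`, and `Δ` lowers Newton coefficients by one place just as `N` lowers
the chain. The degree bound kills the coefficient of order `m` that the truncated sum omits. -/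
theorem newtonSum_comp_X_add_one {N : E →L[ℂ] E} {z : ℕ → E} (h0 : N (z 0) = 0)
    (hz : ∀ j, N (z (j + 1)) = z j) {m : ℕ} {P : ℂ[X]} (hP : P.natDegree < m) :
    newtonSum m z (P.comp (X + 1)) = newtonSum m z P + N (newtonSum m z P) := by
  obtain ⟨m, rfl⟩ : ∃ k, m = k + 1 := ⟨m - 1, by omega⟩
  have hN : N (newtonSum (m + 1) z P)
      = ∑ j ∈ Finset.range (m + 1), ((fwdDiff (1 : ℂ))^[j + 1] P.eval 0) • z j := by
    rw [newtonSum, map_sum, Finset.sum_range_succ', Finset.sum_range_succ]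
    simp [h0, hz, Polynomial.fwdDiff_iter_eq_zero_of_degree_lt hP]
  rw [hN, newtonSum, newtonSum, ← Finset.sum_add_distrib]
  refine Finset.sum_congr rfl fun j _ => ?_
  rw [← add_smul]
  congr 1
  have : (P.comp (X + 1)).eval = fun r => P.eval (r + 1) := by ext; simp
  rw [this, fwdDiff_iter_comp_add (f := fun x => P.eval x), Function.iterate_succ_apply', fwdDiff]
  simp

theorem newtonSum_comp_X_add_natCast {N : E →L[ℂ] E} {z : ℕ → E} (h0 : N (z 0) = 0)
    (hz : ∀ j, N (z (j + 1)) = z j) {m : ℕ} {P : ℂ[X]} (hP : P.natDegree < m) (n : ℕ) :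
    newtonSum m z (P.comp (X + C (n : ℂ))) =
      ((ContinuousLinearMap.id ℂ E + N) ^ n) (newtonSum m z P) := by
  induction n with
  | zero => simp
  | succ n ih =>
    have hdeg : (P.comp (X + C (n : ℂ))).natDegree < m := by
      rwa [natDegree_comp, natDegree_X_add_C, mul_one]
    have hcomp : P.comp (X + C ((n + 1 : ℕ) : ℂ)) = (P.comp (X + C (n : ℂ))).comp (X + 1) := by
      rw [comp_assoc]
      simp [add_assoc, add_comm]
    rw [hcomp, newtonSum_comp_X_add_one h0 hz hdeg, ih, pow_succ']
    simp

/-- The `j`-th Newton coefficient is a fixed combination of the values at `0, …, j`, so convergence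
at the naturals suffices. -/
theorem tendsto_newtonSum {m : ℕ} {z : ℕ → E} {P : ℕ → ℂ[X]} {Q : ℂ[X]}
    (h : ∀ k : ℕ, Tendsto (fun n => (P n).eval (k : ℂ)) atTop (𝓝 (Q.eval (k : ℂ)))) :
    Tendsto (fun n => newtonSum m z (P n)) atTop (𝓝 (newtonSum m z Q)) := by
  refine tendsto_finsetSum _ fun j _ => Tendsto.smul_const ?_ _
  simp only [fwdDiff_iter_eq_sum_shift]
  refine tendsto_finsetSum _ fun k _ => ?_
  simpa using (h k).const_smul ((-1 : ℤ) ^ (j - k) * (j.choose k : ℤ))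

/-- The binomial coefficient `t ↦ t.choose d` as a polynomial. -/
noncomputable def binomialPoly (d : ℕ) : ℂ[X] := C ((d.factorial : ℂ)⁻¹) * descPochhammer ℂ d

theorem natDegree_binomialPoly_le (d : ℕ) : (binomialPoly d).natDegree ≤ d := by
  refine (natDegree_C_mul_le _ _).trans ?_
  rw [descPochhammer_natDegree]

theorem eval_binomialPoly (d k : ℕ) : (binomialPoly d).eval (k : ℂ) = (k.choose d : ℂ) := by
  rw [binomialPoly, eval_mul, eval_C, descPochhammer_eval_eq_descFactorial,
    Nat.descFactorial_eq_factorial_mul_choose]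
  push_cast
  field_simp [Nat.cast_ne_zero.2 (Nat.factorial_ne_zero d)]

theorem newtonSum_binomialPoly {m d : ℕ} (hd : d < m) (z : ℕ → E) :
    newtonSum m z (binomialPoly d) = z d := by
  have key : ∀ j, (fwdDiff (1 : ℂ))^[j] (binomialPoly d).eval 0 = if j = d then 1 else 0 := by
    intro j
    have h := congrArg (Int.cast : ℤ → ℂ) (fwdDiff_iter_choose_zero d j)
    rw [fwdDiff_iter_eq_sum_shift] at h ⊢
    push_cast at h
    rw [← h]
    refine Finset.sum_congr rfl fun k _ => ?_
    simp [eval_binomialPoly]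
  simp [newtonSum, key, hd]

theorem tendsto_eval_mul_inv_pow {P : ℂ[X]} {d : ℕ} (hP : P.natDegree ≤ d) (k c : ℂ) :
    Tendsto (fun n : ℕ => P.eval (k + c * n) * ((n : ℂ)⁻¹) ^ (d + 1)) atTop (𝓝 0) := by
  have hinv : Tendsto (fun n : ℕ => ((n : ℂ)⁻¹)) atTop (𝓝 0) := tendsto_inv_atTop_nhds_zero_nat
  have hsum : Tendsto (fun n : ℕ => ∑ i ∈ Finset.range (d + 1),
      P.coeff i * (k * (n : ℂ)⁻¹ + c) ^ i * ((n : ℂ)⁻¹) ^ (d + 1 - i)) atTop (𝓝 0) := by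
    rw [← Finset.sum_const_zero (s := Finset.range (d + 1))]
    refine tendsto_finsetSum _ fun i hi => ?_
    have h1 := (((hinv.const_mul k).add_const c).pow i).const_mul (P.coeff i)
    have hne : d + 1 - i ≠ 0 := by have := Finset.mem_range.1 hi; omega
    simpa [hne] using h1.mul (hinv.pow (d + 1 - i))
  refine hsum.congr' ?_
  filter_upwards [eventually_ge_atTop 1] with n hn
  have hn0 : (n : ℂ) ≠ 0 := by exact_mod_cast (by omega : n ≠ 0)
  rw [eval_eq_sum_range' (Nat.lt_succ_of_le hP), Finset.sum_mul]
  refine Finset.sum_congr rfl fun i hi => ?_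
  have hi' : i ≤ d + 1 := (Finset.mem_range.1 hi).le
  have h1 : k * (n : ℂ)⁻¹ + c = (k + c * n) * (n : ℂ)⁻¹ := by field_simp
  have h2 : ((n : ℂ)⁻¹) ^ (d + 1) = ((n : ℂ)⁻¹) ^ i * ((n : ℂ)⁻¹) ^ (d + 1 - i) := by
    rw [← pow_add]; congr 1; omega
  rw [h1, mul_pow, h2]
  ring

/-- Along a backward chain, orbits of `I + N` starting near `z d` can be driven to `0`. -/
theorem exists_tendsto_self_of_chain {N : E →L[ℂ] E} {z : ℕ → E} (h0 : N (z 0) = 0)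
    (hz : ∀ j, N (z (j + 1)) = z j) (d : ℕ) :
    ∃ u : ℕ → E, Tendsto u atTop (𝓝 (z d)) ∧
      Tendsto (fun n => ((ContinuousLinearMap.id ℂ E + N) ^ n) (u n)) atTop (𝓝 0) := by
  set m := 2 * d + 2
  -- The extra factor tends to 1 pointwise, but after translation by `n` it becomes `(-X / n) ^ (d +
  -- 1)`, which beats the growth `n ^ d` of the translated binomial.
  set P : ℕ → ℂ[X] := fun n => binomialPoly d * (1 - C ((n : ℂ)⁻¹) * X) ^ (d + 1)
  have hdeg : ∀ n, (P n).natDegree < m := by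
    intro n
    have h1 : ((1 - C ((n : ℂ)⁻¹) * X) ^ (d + 1) : ℂ[X]).natDegree ≤ d + 1 := by compute_degree
    have := (natDegree_mul_le (p := binomialPoly d) (q := (1 - C ((n : ℂ)⁻¹) * X) ^ (d + 1)))
    have := natDegree_binomialPoly_le d
    show (binomialPoly d * (1 - C ((n : ℂ)⁻¹) * X) ^ (d + 1)).natDegree < 2 * d + 2
    omega
  have hinv : Tendsto (fun n : ℕ => ((n : ℂ)⁻¹)) atTop (𝓝 0) := tendsto_inv_atTop_nhds_zero_nat
  refine ⟨fun n => newtonSum m z (P n), ?_, ?_⟩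
  · rw [← newtonSum_binomialPoly (show d < m by omega) z]
    refine tendsto_newtonSum fun k => ?_
    simpa [P] using
      (((hinv.mul_const (k : ℂ)).const_sub 1).pow (d + 1)).const_mul ((binomialPoly d).eval (k : ℂ))
  · simp_rw [← newtonSum_comp_X_add_natCast h0 hz (hdeg _)]
    rw [show (0 : E) = newtonSum m z 0 by simp [newtonSum, fwdDiff_iter_eq_sum_shift]]
    refine tendsto_newtonSum fun k => ?_
    have h := (tendsto_eval_mul_inv_pow (natDegree_binomialPoly_le d) (k : ℂ) 1).mul_const
      ((-(k : ℂ)) ^ (d + 1))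
    rw [zero_mul] at h
    rw [eval_zero]
    refine h.congr' ?_
    filter_upwards [eventually_ge_atTop 1] with n hn
    have hn0 : (n : ℂ) ≠ 0 := by exact_mod_cast (by omega : n ≠ 0)
    have h1 : 1 - (n : ℂ)⁻¹ * (k + n) = (n : ℂ)⁻¹ * (-(k : ℂ)) := by field_simp; ring
    simp only [P, eval_comp, eval_mul, eval_pow, eval_sub, eval_one, eval_C, eval_X, eval_add, h1,
      mul_pow, one_mul]
    ring

/-- Along a backward chain, orbits of `I + N` starting near `0` can be driven to `z d`. -/
theorem exists_tendsto_zero_of_chain {N : E →L[ℂ] E} {z : ℕ → E} (h0 : N (z 0) = 0)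
    (hz : ∀ j, N (z (j + 1)) = z j) (d : ℕ) :
    ∃ u : ℕ → E, Tendsto u atTop (𝓝 0) ∧
      Tendsto (fun n => ((ContinuousLinearMap.id ℂ E + N) ^ n) (u n)) atTop (𝓝 (z d)) := by
  set m := 2 * d + 2
  -- The mirror image: the factor is `O(n ^ -(d + 1))` at the start and `(1 + X / n) ^ (d + 1)`
  -- after translation by `n`.
  set P : ℕ → ℂ[X] := fun n =>
    (binomialPoly d).comp (X - C (n : ℂ)) * (C ((n : ℂ)⁻¹) * X) ^ (d + 1)
  have hdeg : ∀ n, (P n).natDegree < m := by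
    intro n
    have h1 : ((C ((n : ℂ)⁻¹) * X) ^ (d + 1) : ℂ[X]).natDegree ≤ d + 1 := by compute_degree
    have := (natDegree_mul_le (p := (binomialPoly d).comp (X - C (n : ℂ)))
      (q := (C ((n : ℂ)⁻¹) * X) ^ (d + 1)))
    have h2 : ((binomialPoly d).comp (X - C (n : ℂ))).natDegree ≤ d := by
      rw [natDegree_comp, natDegree_X_sub_C, mul_one]
      exact natDegree_binomialPoly_le d
    show ((binomialPoly d).comp (X - C (n : ℂ)) * (C ((n : ℂ)⁻¹) * X) ^ (d + 1)).natDegree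
      < 2 * d + 2
    omega
  have hinv : Tendsto (fun n : ℕ => ((n : ℂ)⁻¹)) atTop (𝓝 0) := tendsto_inv_atTop_nhds_zero_nat
  refine ⟨fun n => newtonSum m z (P n), ?_, ?_⟩
  · rw [show (0 : E) = newtonSum m z 0 by simp [newtonSum, fwdDiff_iter_eq_sum_shift]]
    refine tendsto_newtonSum fun k => ?_
    have h := (tendsto_eval_mul_inv_pow (natDegree_binomialPoly_le d) (k : ℂ) (-1)).mul_const
      ((k : ℂ) ^ (d + 1))
    rw [zero_mul] at h
    rw [eval_zero]
    refine h.congr fun n => ?_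
    simp only [P, eval_comp, eval_mul, eval_pow, eval_sub, eval_C, eval_X, mul_pow]
    ring_nf
  · simp_rw [← newtonSum_comp_X_add_natCast h0 hz (hdeg _)]
    rw [← newtonSum_binomialPoly (show d < m by omega) z]
    refine tendsto_newtonSum fun k => ?_
    have h := (((hinv.mul_const (k : ℂ)).add_const 1).pow (d + 1)).const_mul
      ((binomialPoly d).eval (k : ℂ))
    simp only [zero_mul, zero_add, one_pow, mul_one] at h
    refine h.congr' ?_
    filter_upwards [eventually_ge_atTop 1] with n hn
    have hn0 : (n : ℂ) ≠ 0 := by exact_mod_cast (by omega : n ≠ 0)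
    have h1 : (n : ℂ)⁻¹ * (k + n) = (n : ℂ)⁻¹ * k + 1 := by field_simp
    simp [P, h1]

/-- If `N` maps a subspace onto itself and is locally nilpotent on it, every vector of the subspace
lies on an infinite backward chain of `N`. -/
theorem exists_chain {N : E →L[ℂ] E} {D : Submodule ℂ E} (hsurj : ∀ x ∈ D, ∃ y ∈ D, N y = x)
    (hnil : ∀ x ∈ D, ∃ k : ℕ, (N ^ k) x = 0) {x : E} (hx : x ∈ D) :
    ∃ (z : ℕ → E) (d : ℕ), N (z 0) = 0 ∧ (∀ j, N (z (j + 1)) = z j) ∧ z d = x := by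
  choose! g hgD hgN using hsurj
  obtain ⟨k, hk⟩ := hnil x hx
  have hg : ∀ j, g^[j] x ∈ D := fun j => by
    induction j with
    | zero => exact hx
    | succ j ih => rw [Function.iterate_succ_apply']; exact hgD _ ih
  -- Below `x` the chain consists of its images under powers of `N`, above it of chosen preimages.
  refine ⟨fun j => if j ≤ k then (N ^ (k - j)) x else g^[j - k] x, k, ?_, fun j => ?_, by simp⟩
  · simp [hk]
  · rcases lt_trichotomy j k with h | rfl | h
    · have h1 : k - j = (k - (j + 1)) + 1 := by omega
      simp only [show j + 1 ≤ k by omega, h.le, if_true, h1, pow_succ',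
        mul_apply_eq_comp]
    · simp [hgN x hx]
    · have h1 : j + 1 - k = (j - k) + 1 := by omega
      simp only [show ¬ j + 1 ≤ k by omega, show ¬ j ≤ k by omega, if_false, h1,
        Function.iterate_succ_apply']
      exact hgN _ (hg _)

/-- If `N` maps a dense subspace onto itself and is locally nilpotent on it, then `l I + N` is
mixing for every unimodular `l`. -/
theorem isMixingOperator_smul_id_add {N : E →L[ℂ] E} {D : Submodule ℂ E} (hD : Dense (D : Set E))
    (hsurj : ∀ x ∈ D, ∃ y ∈ D, N y = x) (hnil : ∀ x ∈ D, ∃ k : ℕ, (N ^ k) x = 0)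
    {l : ℂ} (hl : ‖l‖ = 1) : IsMixingOperator (l • ContinuousLinearMap.id ℂ E + N) := by
  intro U V hU hV hUne hVne
  obtain ⟨x, hxU, hxD⟩ := hD.inter_open_nonempty U hU hUne
  obtain ⟨y, hyV, hyD⟩ := hD.inter_open_nonempty V hV hVne
  have hl0 : l ≠ 0 := fun h => by simp [h] at hl
  set M : E →L[ℂ] E := l⁻¹ • N with hM
  have hT : ∀ n : ℕ, (l • ContinuousLinearMap.id ℂ E + N) ^ n
      = l ^ n • (ContinuousLinearMap.id ℂ E + M) ^ n := fun n => by
    rw [← _root_.smul_pow, smul_add, hM, smul_inv_smul₀ hl0]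
  have hMsurj : ∀ x ∈ D, ∃ y ∈ D, M y = x := fun x hx => by
    obtain ⟨y, hy, rfl⟩ := hsurj x hx
    exact ⟨l • y, D.smul_mem _ hy, by simp [hM, hl0]⟩
  have hMnil : ∀ x ∈ D, ∃ k : ℕ, (M ^ k) x = 0 := fun x hx => by
    obtain ⟨k, hk⟩ := hnil x hx
    exact ⟨k, by rw [hM, _root_.smul_pow, smul_apply, hk, smul_zero]⟩
  obtain ⟨z, d, hz0, hz, rfl⟩ := exists_chain hMsurj hMnil hxD
  obtain ⟨w, e, hw0, hw, rfl⟩ := exists_chain hMsurj hMnil hyD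
  obtain ⟨u, hu, hTu⟩ := exists_tendsto_self_of_chain hz0 hz d
  obtain ⟨v, hv, hTv⟩ := exists_tendsto_zero_of_chain hw0 hw e
  have hu' : Tendsto (fun n => ((l • ContinuousLinearMap.id ℂ E + N) ^ n) (u n)) atTop (𝓝 0) := by
    rw [tendsto_zero_iff_norm_tendsto_zero] at hTu ⊢
    simpa [hT, norm_smul, hl] using hTu
  -- The scalar cancels the `l ^ n` in the power of the operator; being unimodular, it does not
  -- affect convergence to `0`.
  have hv' : Tendsto (fun n => (l ^ n)⁻¹ • v n) atTop (𝓝 0) := by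
    rw [tendsto_zero_iff_norm_tendsto_zero] at hv ⊢
    simpa [norm_smul, hl] using hv
  have hstart : Tendsto (fun n => u n + (l ^ n)⁻¹ • v n) atTop (𝓝 (z d)) := by
    simpa using hu.add hv'
  have hend : Tendsto (fun n => ((l • ContinuousLinearMap.id ℂ E + N) ^ n)
      (u n + (l ^ n)⁻¹ • v n)) atTop (𝓝 (w e)) := by
    have h := hu'.add hTv
    rw [zero_add] at h
    refine h.congr fun n => ?_
    rw [map_add, map_smul, hT, smul_apply _ _ (v n), inv_smul_smul₀ (pow_ne_zero n hl0)]
  obtain ⟨n₀, hn₀⟩ := eventually_atTop.1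
    ((hstart.eventually (hU.mem_nhds hxU)).and (hend.eventually (hV.mem_nhds hyV)))
  exact ⟨n₀, fun n hn => ⟨_, ⟨_, (hn₀ n hn.le).1, rfl⟩, (hn₀ n hn.le).2⟩⟩

end Criterion

/-! ### Small perturbations joining the blocks into one shift. -/

section Perturbation

variable {E : Type*} [NormedAddCommGroup E] [NormedSpace ℂ E] {α : Type*}

/-- The images of the members of a minimal system under an operator can be changed to any other
vectors by a perturbation that is small if the changes are summably small. -/
theorem IsNormalisedMinimalFundamental.exists_perturbation [CompleteSpace E] {e : α → E}
    {f : α → (E →L[ℂ] ℂ)} (hef : IsNormalisedMinimalFundamental e f) (S : E →L[ℂ] E) (v : α → E)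
    {g : α → ℝ} {c : ℝ} (hg : HasSum g c) (hv : ∀ p, ‖f p‖ * ‖v p - S (e p)‖ ≤ g p) :
    ∃ N : E →L[ℂ] E, ‖N - S‖ ≤ c ∧ ∀ p, N (e p) = v p := by
  have hle : ∀ p, ‖(f p).smulRight (v p - S (e p))‖ ≤ g p := fun p => by
    rw [ContinuousLinearMap.norm_smulRight_apply]
    exact hv p
  have hs : Summable fun p => (f p).smulRight (v p - S (e p)) :=
    Summable.of_norm_bounded hg.summable hle
  refine ⟨S + ∑' p, (f p).smulRight (v p - S (e p)), ?_, fun q => ?_⟩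
  · rw [add_sub_cancel_left]
    exact tsum_of_norm_bounded hg hle
  · have h1 := hs.hasSum.mapL (ContinuousLinearMap.apply ℂ E (e q))
    have h2 : HasSum (fun p => ContinuousLinearMap.apply ℂ E (e q)
        ((f p).smulRight (v p - S (e p)))) (v q - S (e q)) := by
      convert hasSum_single q fun p hp => ?_ using 1
      · simp [hef.apply_self]
      · simp [hef.apply_of_ne p q hp]
    have h3 := h1.unique h2
    rw [ContinuousLinearMap.apply_apply] at h3
    rw [add_apply, h3, add_sub_cancel]

/-- A partition of the index set `α` of a system into blocks, each of them traversed by `next` and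
ending at its member `last β`. Every member of `α` is the distinguished member `first β` of its
block or has a predecessor in it. -/
structure BlockDecomposition (next : α → α) (B : Type*) where
  block : α → B
  last : B → α
  first : B → α
  block_last : ∀ β, block (last β) = β
  block_first : ∀ β, block (first β) = β
  -- A block may extend infinitely to the left; `first` is then an arbitrary member.
  eq_first_or : ∀ q, q = first (block q) ∨ ∃ p, p ≠ last (block p) ∧ next p = q
  -- Backward induction: it encodes that iterating `next` from any member of a block reaches its
  -- end.
  induct : ∀ (Q : α → Prop) (β : B), Q (last β) →
    (∀ p, p ≠ last (block p) → Q (next p) → Q p) → ∀ p, block p = β → Q p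

theorem BlockDecomposition.last_injective {next : α → α} {B : Type*}
    (d : BlockDecomposition next B) : Function.Injective d.last := fun β γ h => by
  rw [← d.block_last β, h, d.block_last]

/-- If `N` shifts the blocks of the system with nonzero weights, the last vector of each block being
sent to a multiple of the first vector of the preceding block, then `l I + N` is mixing for every
unimodular `l`. -/
theorem isMixingOperator_of_shift {e : α → E}
    (he : Dense (Submodule.span ℂ (Set.range e) : Set E)) {next : α → α}
    (d : BlockDecomposition next ℕ) {N : E →L[ℂ] E} {w : α → ℂ} (hw : ∀ p, w p ≠ 0)
    (hN : ∀ p, p ≠ d.last (d.block p) → N (e p) = w p • e (next p))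
    (h0 : N (e (d.last 0)) = 0)
    (hsucc : ∀ n, N (e (d.last (n + 1))) = w (d.last (n + 1)) • e (d.first n))
    {l : ℂ} (hl : ‖l‖ = 1) : IsMixingOperator (l • ContinuousLinearMap.id ℂ E + N) := by
  have hpow : ∀ {k : ℕ} {x : E}, (N ^ k) (N x) = 0 → (N ^ (k + 1)) x = 0 := fun h => by
    rwa [pow_succ, mul_apply_eq_comp]
  have hnil : ∀ n, ∀ p, d.block p = n → ∃ k : ℕ, (N ^ k) (e p) = 0 := by
    intro n
    induction n with
    | zero =>
      refine d.induct _ 0 ⟨1, by simpa using h0⟩ fun p hp ⟨k, hk⟩ => ⟨k + 1, hpow ?_⟩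
      rw [hN p hp, map_smul, hk, smul_zero]
    | succ n ih =>
      refine d.induct _ (n + 1) ?_ fun p hp ⟨k, hk⟩ => ⟨k + 1, hpow ?_⟩
      · obtain ⟨k, hk⟩ := ih _ (d.block_first n)
        refine ⟨k + 1, hpow ?_⟩
        rw [hsucc, map_smul, hk, smul_zero]
      · rw [hN p hp, map_smul, hk, smul_zero]
  refine isMixingOperator_smul_id_add he ?_ ?_ hl
  · have hle : Submodule.span ℂ (Set.range e) ≤
        (Submodule.span ℂ (Set.range e)).map (N : E →ₗ[ℂ] E) := by
      rw [Submodule.span_le]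
      rintro _ ⟨q, rfl⟩
      have hmem : ∀ p, N (e p) = w p • e q → e q ∈
          (Submodule.span ℂ (Set.range e)).map (N : E →ₗ[ℂ] E) := fun p hp =>
        ⟨(w p)⁻¹ • e p, Submodule.smul_mem _ _ (Submodule.subset_span ⟨p, rfl⟩), by
          simp [hp, inv_smul_smul₀ (hw p)]⟩
      rcases d.eq_first_or q with h | ⟨p, hp, rfl⟩
      · exact hmem _ ((hsucc _).trans (by rw [← h]))
      · exact hmem _ (hN p hp)
    intro x hx
    obtain ⟨y, hy, rfl⟩ := hle hx
    exact ⟨y, hy, rfl⟩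
  · intro x hx
    induction hx using Submodule.span_induction with
    | mem x hx =>
      obtain ⟨p, rfl⟩ := hx
      exact hnil _ p rfl
    | zero => exact ⟨0, by simp⟩
    | add x y _ _ hx hy =>
      obtain ⟨k, hk⟩ := hx
      obtain ⟨m, hm⟩ := hy
      refine ⟨k + m, ?_⟩
      have hx : (N ^ (k + m)) x = 0 := by
        rw [add_comm, pow_add, mul_apply_eq_comp, hk, map_zero]
      rw [map_add, hx, pow_add, mul_apply_eq_comp, hm, map_zero, add_zero]
    | smul c x _ hx =>
      obtain ⟨k, hk⟩ := hx
      exact ⟨k, by rw [map_smul, hk, smul_zero]⟩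

/-- Relabelling of the blocks. -/
def BlockDecomposition.relabel {next : α → α} {B C : Type*} (d : BlockDecomposition next B)
    (φ : B ≃ C) : BlockDecomposition next C where
  block p := φ (d.block p)
  last c := d.last (φ.symm c)
  first c := d.first (φ.symm c)
  block_last c := by simp [d.block_last]
  block_first c := by simp [d.block_first]
  eq_first_or q := by simpa using d.eq_first_or q
  induct Q c hlast hstep p hp := d.induct Q (φ.symm c) hlast (by simpa using hstep) p (by
    rw [← hp, φ.symm_apply_apply])

/-- A weighted shift along the blocks of a minimal system that is summably small at the ends of the
blocks is close to operators `N` with `l I + N` mixing. -/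
theorem IsNormalisedMinimalFundamental.exists_isMixingOperator_near [CompleteSpace E] [Countable α]
    {e : α → E} {f : α → (E →L[ℂ] ℂ)} (hef : IsNormalisedMinimalFundamental e f)
    {S : E →L[ℂ] E} {next : α → α} {a : α → ℂ} (hS : ∀ p, S (e p) = a p • e (next p))
    (d : BlockDecomposition next ℕ) {η : ℕ → ℝ} {ε : ℝ} (hε : 0 < ε) (hη : HasSum η ε)
    (hcut : ∀ n, ‖a (d.last n)‖ * ‖f (d.last n)‖ ≤ η n) {l : ℂ} (hl : ‖l‖ = 1) :
    ∃ N : E →L[ℂ] E, ‖N - S‖ ≤ 2 * ε ∧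
      IsMixingOperator (l • ContinuousLinearMap.id ℂ E + N) := by
  classical
  cases nonempty_encodable α
  obtain ⟨δ, hδ, c, hc, hcε⟩ := posSumOfEncodable hε α
  have hf : ∀ p, 0 < ‖f p‖ := fun p => norm_pos_iff.2 fun h => by
    simpa [h] using hef.apply_self p
  -- Dividing by `‖f p‖` makes the rank-one change at `p` of weight `t p` have norm `δ p`.
  set t : α → ℂ := fun p => ((δ p / ‖f p‖ : ℝ) : ℂ) with ht
  have htnorm : ∀ p, ‖f p‖ * ‖t p‖ = δ p := fun p => by
    rw [ht, Complex.norm_real, Real.norm_of_nonneg (div_pos (hδ p) (hf p)).le,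
      mul_div_cancel₀ _ (hf p).ne']
  have ht0 : ∀ p, t p ≠ 0 := fun p =>
    Complex.ofReal_ne_zero.2 (div_pos (hδ p) (hf p)).ne'
  set w : α → ℂ := fun p => if p = d.last (d.block p) ∨ a p = 0 then t p else a p with hw
  -- Targets of the block ends: block `0` is annihilated, which starts the nilpotency induction.
  set g : ℕ → E := fun n => Nat.casesOn n 0 fun n => e (d.first n) with hg
  have hgnorm : ∀ n, ‖g n‖ ≤ 1 := fun n => by
    cases n with
    | zero => simp [hg]
    | succ n => simp [hg, hef.norm_eq_one]
  set v : α → E := fun p =>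
    if p = d.last (d.block p) then w p • g (d.block p) else w p • e (next p) with hv
  -- `δ` pays for the new weights, `η` for removing the old image of a block end.
  have hsum : HasSum (fun p => δ p + Function.extend d.last η 0 p) (c + ε) :=
    hc.add ((hasSum_extend_zero d.last_injective).2 hη)
  obtain ⟨N, hNS, hN⟩ := hef.exists_perturbation S v hsum fun p => by
    by_cases hp : p = d.last (d.block p)
    · have hvp : v p = t p • g (d.block p) := by simp only [hv, hw, if_pos hp, if_pos (Or.inl hp)]
      have hext : Function.extend d.last η 0 p = η (d.block p) := by
        conv_lhs => rw [hp]
        exact d.last_injective.extend_apply _ _ _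
      have hη' : ‖a p‖ * ‖f p‖ ≤ η (d.block p) := by
        have := hcut (d.block p)
        rwa [← hp] at this
      have h1 : ‖v p - S (e p)‖ ≤ ‖t p‖ + ‖a p‖ := by
        rw [hvp, hS]
        refine (norm_sub_le _ _).trans ?_
        rw [norm_smul, norm_smul, hef.norm_eq_one, mul_one]
        gcongr
        exact mul_le_of_le_one_right (norm_nonneg _) (hgnorm _)
      calc ‖f p‖ * ‖v p - S (e p)‖ ≤ ‖f p‖ * (‖t p‖ + ‖a p‖) := by gcongr
        _ = δ p + ‖a p‖ * ‖f p‖ := by rw [mul_add, htnorm, mul_comm ‖a p‖]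
        _ ≤ _ := by rw [hext]; gcongr
    · have hext : Function.extend d.last η 0 p = 0 :=
        Function.extend_apply' _ _ _ fun ⟨n, hn⟩ => hp (by rw [← hn, d.block_last])
      rw [hext, add_zero]
      have hvp : v p = w p • e (next p) := by simp only [hv, if_neg hp]
      rw [hvp, hS, ← sub_smul, norm_smul, hef.norm_eq_one, mul_one]
      by_cases ha : a p = 0
      · rw [show w p = t p by simp only [hw, if_pos (Or.inr ha)], ha, sub_zero, htnorm]
      · rw [show w p = a p by simp [hw, hp, ha]]
        simpa using (hδ p).le
  refine ⟨N, by linarith, isMixingOperator_of_shift hef.dense_span d (w := w) ?_ ?_ ?_ ?_ hl⟩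
  · intro p
    by_cases h : p = d.last (d.block p) ∨ a p = 0
    · simpa only [hw, if_pos h] using ht0 p
    · simpa only [hw, if_neg h] using fun ha => h (Or.inr ha)
  · intro p hp
    rw [hN, hv]
    exact if_neg hp
  · rw [hN]
    simp [hv, hg, d.block_last]
  · intro n
    rw [hN]
    simp [hv, hg, d.block_last]

end Perturbation

/-! ### Cutting chains into blocks and assembling the blocks. -/

section Blocks

/-- Cutting an ordered chain after the terms of an unbounded increasing sequence. -/
theorem exists_blockDecomposition {J : Type*} [LinearOrder J] [SuccOrder J] [NoMaxOrder J]
    [IsSuccArchimedean J] {c : ℕ → J} (hc : StrictMono c) {s : J} (hs : s ≤ c 0)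
    (hs' : ∀ q ≤ c 0, q = s ∨ ∃ p, Order.succ p = q) :
    ∃ d : BlockDecomposition (Order.succ : J → J) ℕ, d.last = c := by
  classical
  have hub : ∀ j, ∃ r, j ≤ c r := fun j => by
    by_contra! h
    exact hc.not_bddAbove_range_of_isSuccArchimedean ⟨j, by rintro _ ⟨r, rfl⟩; exact (h r).le⟩
  have hfind : ∀ {j r}, Nat.find (hub j) = r ↔ j ≤ c r ∧ ∀ m < r, c m < j := fun {j r} => by
    rw [Nat.find_eq_iff]
    simp
  have hle : ∀ q, q ≤ c (Nat.find (hub q)) := fun q => Nat.find_spec (hub q)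
  have hlt : ∀ {q m}, m < Nat.find (hub q) → c m < q := fun h => not_le.1 (Nat.find_min (hub _) h)
  refine ⟨{
    -- Block `r` is the set of `j` with `c (r - 1) < j ≤ c r`, without lower bound for `r = 0`.
    block := fun j => Nat.find (hub j)
    last := c
    first := fun r => Nat.casesOn r s fun r => Order.succ (c r)
    block_last := fun r => hfind.2 ⟨le_rfl, fun m hm => hc hm⟩
    block_first := ?_
    eq_first_or := ?_
    induct := ?_ }, rfl⟩
  · intro r
    cases r with
    | zero => exact hfind.2 ⟨hs, fun m hm => absurd hm (Nat.not_lt_zero m)⟩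
    | succ r =>
      exact hfind.2 ⟨Order.succ_le_of_lt (hc r.lt_succ_self), fun m hm =>
        (hc.monotone (Nat.lt_succ_iff.1 hm)).trans_lt (Order.lt_succ _)⟩
  · intro q
    have hpred : ∀ p, Order.succ p = q → (∀ m < Nat.find (hub q), c m < p) →
        ∃ p, p ≠ c (Nat.find (hub p)) ∧ Order.succ p = q := fun p hp hm => by
      have hpq : p < q := hp ▸ Order.lt_succ p
      have hblock : Nat.find (hub p) = Nat.find (hub q) :=
        hfind.2 ⟨hpq.le.trans (hle q), hm⟩
      exact ⟨p, hblock ▸ (hpq.trans_le (hle q)).ne, hp⟩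
    rcases hr : Nat.find (hub q) with _ | r
    · have hq := hle q
      rw [hr] at hq
      refine (hs' q hq).imp id fun ⟨p, hp⟩ => hpred p hp fun m hm => ?_
      rw [hr] at hm
      exact absurd hm (Nat.not_lt_zero m)
    · have hq : c r < q := hlt (by rw [hr]; exact r.lt_succ_self)
      obtain ⟨k, hk⟩ := exists_succ_iterate_of_le (Order.succ_le_of_lt hq)
      rcases k with _ | k
      · exact Or.inl hk.symm
      · right
        rw [Function.iterate_succ_apply'] at hk
        refine hpred _ hk fun m hm => ?_
        rw [hr] at hm
        exact (hc.monotone (Nat.lt_succ_iff.1 hm)).trans_lt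
          ((Order.lt_succ _).trans_le (Order.le_succ_iterate k _))
  · intro Q r hlast hstep p hp
    have key : ∀ k p, Order.succ^[k] p = c r → Nat.find (hub p) = r → Q p := by
      intro k
      induction k with
      | zero => rintro p rfl -; exact hlast
      | succ k ih =>
        intro p hk hpr
        by_cases hpc : p = c r
        · rw [hpc]; exact hlast
        · have hp' : p ≤ c r := hpr ▸ hle p
          refine hstep p (by rwa [hpr]) (ih _ hk (hfind.2
            ⟨Order.succ_le_of_lt (lt_of_le_of_ne hp' hpc), fun m hm => ?_⟩))
          exact (hlt (hpr ▸ hm)).trans (Order.lt_succ p)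
    obtain ⟨k, hk⟩ := exists_succ_iterate_of_le (show p ≤ c r from hp ▸ hle p)
    exact key k p hk hp

/-- Block decompositions of a family of chains, put side by side. -/
def BlockDecomposition.prod {I J B : Type*} {next : J → J} (d : I → BlockDecomposition next B) :
    BlockDecomposition (fun p : I × J => (p.1, next p.2)) (I × B) where
  block p := (p.1, (d p.1).block p.2)
  last β := (β.1, (d β.1).last β.2)
  first β := (β.1, (d β.1).first β.2)
  block_last β := by simp [(d β.1).block_last]
  block_first β := by simp [(d β.1).block_first]
  eq_first_or := by
    rintro ⟨i, q⟩
    rcases (d i).eq_first_or q with h | ⟨p, hp, rfl⟩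
    · exact Or.inl (Prod.ext rfl h)
    · exact Or.inr ⟨(i, p), fun h => hp (congrArg Prod.snd h), rfl⟩
  induct Q := by
    rintro ⟨i, β⟩ hlast hstep ⟨i', p⟩ hp
    obtain ⟨rfl, hp⟩ := Prod.ext_iff.1 hp
    exact (d i').induct (fun p => Q (i', p)) β hlast
      (fun p hp => hstep (i', p) fun h => hp (congrArg Prod.snd h)) p hp

/-- The disjoint union of two block decompositions. -/
def BlockDecomposition.sum {α₁ α₂ B₁ B₂ : Type*} {next₁ : α₁ → α₁} {next₂ : α₂ → α₂}
    (d₁ : BlockDecomposition next₁ B₁) (d₂ : BlockDecomposition next₂ B₂) :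
    BlockDecomposition (Sum.map next₁ next₂) (B₁ ⊕ B₂) where
  block := Sum.map d₁.block d₂.block
  last := Sum.map d₁.last d₂.last
  first := Sum.map d₁.first d₂.first
  block_last := by rintro (β | β) <;> simp [d₁.block_last, d₂.block_last]
  block_first := by rintro (β | β) <;> simp [d₁.block_first, d₂.block_first]
  eq_first_or := by
    rintro (q | q)
    · rcases d₁.eq_first_or q with h | ⟨p, hp, rfl⟩
      · exact Or.inl (congrArg Sum.inl h)
      · exact Or.inr ⟨Sum.inl p, fun h => hp (Sum.inl_injective h), rfl⟩
    · rcases d₂.eq_first_or q with h | ⟨p, hp, rfl⟩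
      · exact Or.inl (congrArg Sum.inr h)
      · exact Or.inr ⟨Sum.inr p, fun h => hp (Sum.inr_injective h), rfl⟩
  induct Q := by
    rintro (β | β) hlast hstep (p | p) hp
    · exact d₁.induct (fun p => Q (Sum.inl p)) β hlast
        (fun p hp => hstep (Sum.inl p) fun h => hp (Sum.inl_injective h)) p (Sum.inl_injective hp)
    · cases hp
    · cases hp
    · exact d₂.induct (fun p => Q (Sum.inr p)) β hlast
        (fun p hp => hstep (Sum.inr p) fun h => hp (Sum.inr_injective h)) p (Sum.inr_injective hp)

/-- A sequence of cuts along which `g` tends to zero can be thinned out so that `g` is bounded by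
prescribed positive numbers at the cuts. -/
theorem exists_strictMono_forall_lt {J : Type*} [Preorder J] {g : J → ℝ} {n : ℕ → J}
    (hn : StrictMono n) (hg : Tendsto (fun j => g (n j)) atTop (𝓝 0)) {η : ℕ → ℝ}
    (hη : ∀ r, 0 < η r) : ∃ c : ℕ → J, StrictMono c ∧ ∀ r, g (c r) < η r := by
  obtain ⟨φ, hφ, h⟩ := extraction_forall_of_eventually fun r => hg.eventually_lt_const (hη r)
  exact ⟨n ∘ φ, hn.comp hφ, h⟩

end Blocks

theorem proposition3p3 {X : Type*} [NormedAddCommGroup X] [NormedSpace ℂ X] [CompleteSpace X]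
    [TopologicalSpace.SeparableSpace X] (hX : ¬ FiniteDimensional ℂ X)
    (S : X →L[ℂ] X) (I₁ I₂ : ℕ∞) (hI : ¬ (I₁ = 0 ∧ I₂ = 0))
    (x : ChainIndex I₁ → ℕ → X) (y : ChainIndex I₂ → ℤ → X)
    (x' : ChainIndex I₁ → ℕ → (X →L[ℂ] ℂ)) (y' : ChainIndex I₂ → ℤ → (X →L[ℂ] ℂ))
    (hxy : IsNormalisedMinimalFundamental (chainSystem x y) (chainSystem x' y'))
    (a : ChainIndex I₁ → ℕ → ℂ) (b : ChainIndex I₂ → ℤ → ℂ)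
    (hSx : ∀ i j, S (x i j) = a i j • x i (j + 1))
    (hSy : ∀ i j, S (y i j) = b i j • y i (j + 1))
    (ha : ∀ i, ∃ n : ℕ → ℕ, StrictMono n ∧
      Tendsto (fun j => ‖a i (n j)‖ * ‖x' i (n j)‖) atTop (𝓝 0))
    (hb : ∀ i, ∃ m : ℕ → ℤ, StrictMono m ∧
      Tendsto (fun j => ‖b i (m j)‖ * ‖y' i (m j)‖) atTop (𝓝 0))
    (l : ℂ) (hl : ‖l‖ = 1) :
    l • ContinuousLinearMap.id ℂ X + S ∈ closure {T : X →L[ℂ] X | IsMixingOperator T} := by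
  rw [Metric.mem_closure_iff]
  intro ε hε
  have hne : Nonempty (ChainIndex I₁ ⊕ ChainIndex I₂) := by
    by_cases h₁ : I₁ = 0
    · exact ⟨Sum.inr ⟨0, by simpa using pos_iff_ne_zero.2 fun h₂ => hI ⟨h₁, h₂⟩⟩⟩
    · exact ⟨Sum.inl ⟨0, by simpa using pos_iff_ne_zero.2 h₁⟩⟩
  have hinf : Infinite ((ChainIndex I₁ × ℕ) ⊕ (ChainIndex I₂ × ℕ)) := by
    rcases hne with ⟨i | i⟩
    · exact Infinite.of_injective (fun r : ℕ => Sum.inl (i, r)) fun r s h => by simpa using h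
    · exact Infinite.of_injective (fun r : ℕ => Sum.inr (i, r)) fun r s h => by simpa using h
  -- One enumeration of the blocks of all chains; the tolerance at each cut is prescribed through
  -- it.
  obtain ⟨φ⟩ : Nonempty ((ChainIndex I₁ × ℕ) ⊕ (ChainIndex I₂ × ℕ) ≃ ℕ) :=
    nonempty_equiv_of_countable
  -- The perturbation will cost at most `2 * θ ≤ 2 * ε / 3 < ε`.
  obtain ⟨η, hη, θ, hθ, hθε⟩ := posSumOfEncodable (show 0 < ε / 3 by positivity) ℕ
  have hθ0 : 0 < θ := (hη 0).trans_le (le_hasSum hθ 0 fun n _ => (hη n).le)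
  have hx : ∀ i, ∃ d : BlockDecomposition (Order.succ : ℕ → ℕ) ℕ,
      ∀ r, ‖a i (d.last r)‖ * ‖x' i (d.last r)‖ < η (φ (Sum.inl (i, r))) := fun i => by
    obtain ⟨n, hn, hlim⟩ := ha i
    obtain ⟨c, hc, hcη⟩ := exists_strictMono_forall_lt (g := fun j => ‖a i j‖ * ‖x' i j‖) hn hlim
      fun r => hη (φ (Sum.inl (i, r)))
    obtain ⟨d, rfl⟩ := exists_blockDecomposition hc (Nat.zero_le _) fun q _ =>
      (Nat.eq_zero_or_eq_succ_pred q).imp id fun h => ⟨q.pred, h.symm⟩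
    exact ⟨d, hcη⟩
  have hy : ∀ i, ∃ d : BlockDecomposition (Order.succ : ℤ → ℤ) ℕ,
      ∀ r, ‖b i (d.last r)‖ * ‖y' i (d.last r)‖ < η (φ (Sum.inr (i, r))) := fun i => by
    obtain ⟨n, hn, hlim⟩ := hb i
    obtain ⟨c, hc, hcη⟩ := exists_strictMono_forall_lt (g := fun j => ‖b i j‖ * ‖y' i j‖) hn hlim
      fun r => hη (φ (Sum.inr (i, r)))
    -- The initial block of a bilateral chain has no least element, so its end `c 0` serves as
    -- landing point; every integer has a predecessor.
    obtain ⟨d, rfl⟩ := exists_blockDecomposition hc le_rfl fun q _ =>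
      Or.inr ⟨q - 1, by simp⟩
    exact ⟨d, hcη⟩
  choose dx hdx using hx
  choose dy hdy using hy
  obtain ⟨N, hNS, hN⟩ := hxy.exists_isMixingOperator_near (S := S)
    (a := Sum.elim (fun p => a p.1 p.2) fun p => b p.1 p.2)
    (by rintro (⟨i, j⟩ | ⟨i, j⟩) <;> simp [chainSystem, hSx, hSy])
    (((BlockDecomposition.prod dx).sum (BlockDecomposition.prod dy)).relabel φ) hθ0 hθ
    (by
      intro n
      obtain ⟨β, rfl⟩ := φ.surjective n
      rcases β with ⟨i, r⟩ | ⟨i, r⟩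
      · simpa [BlockDecomposition.relabel, BlockDecomposition.sum, BlockDecomposition.prod,
          chainSystem] using (hdx i r).le
      · simpa [BlockDecomposition.relabel, BlockDecomposition.sum, BlockDecomposition.prod,
          chainSystem] using (hdy i r).le) hl
  refine ⟨_, hN, ?_⟩
  rw [dist_comm, dist_eq_norm, add_sub_add_left_eq_sub]
  linarith
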